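/- Let $n\ge 1$ and let $u\in\mathbb{Z}^n$ have positive entries; put $B_u=\{x\in\mathbb{Z}^n : 0\le x_i\le u_i \text{ for } i=1,\dots,n\}$. For integer vectors write $x\preceq y$ (equivalently $y\succeq x$) if $x=y$ or $x_i<y_i$ at the largest index $i$ with $x_i\ne y_i$. A vector $a\in\mathbb{Z}^n$ with strictly positive entries is called superincreasing (with respect to $u$) if $\sum_{k<i}a_ku_k\le a_i$ for all $i=2,\dots,n$. For superincreasing $a,w$ and positive integers $b,d$ define the superincreasing knapsacks $$K^{\le}=\{x\in B_u : a^{\top}x\le b\},\qquad K^{\ge}=\{x\in B_u : w^{\top}x\ge d\},$$ and the vectors $\theta,\gamma$, recursively for $i=n,n-1,\dots,1$, by $$\theta_i=\min\Bigl\{u_i,\Bigl\lfloor\tfrac{b-\sum_{k>i}a_k\theta_k}{a_i}\Bigr\rfloor\Bigr\},\qquad \gamma_i=u_i-\min\Bigl\{u_i,\Bigl\lfloor\tfrac{w^{\top}u-d-\sum_{k>i}w_k(u_k-\gamma_k)}{w_i}\Bigr\rfloor\Bigr\}.$$ (1) For any $\gamma,\theta\in B_u$, $$\operatorname{conv}\{x\in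 B_u:\gamma\preceq x\preceq\theta\}=\operatorname{conv}\{x\in B_u: x\succeq\gamma\}\cap\operatorname{conv}\{x\in B_u: x\preceq\theta\}.$$ (2) For superincreasing $a,w$ with strictly positive integer entries and positive integers $b,d$, with $\theta,\gamma$ as defined above, $K^{\le}=\{x\in B_u:x\preceq\theta\}$, $K^{\ge}=\{x\in B_u:x\succeq\gamma\}$, and $$\operatorname{conv}(K^{\le}\cap K^{\ge})=\operatorname{conv}(K^{\le})\cap\operatorname{conv}(K^{\ge}).$$ (3) There is an absolute constant $C$ such that for every $n\ge1$ and every $u$ as above, the convex hull of the intersection of any nonempty finite family of superincreasing knapsacks over $B_u$, each of $\le$- or $\ge$-type, with strictly positive integer weights and a positive integer right-hand side (the weights and right-hand sides may differ between the knapsacks), is the solution set in $\mathbb{R}^n$ of a system of at most $Cn$ linear inequalities; in particular the number of inequalities is $O(n)$ independently of the number of knapsacks. -/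

import Mathlib

namespace SuperincreasingKnapsack

/-- The discrete box of all integer vectors `x` with `0 ≤ x i ≤ u i` for every `i`. -/
def box {n : ℕ} (u : Fin n → ℤ) : Set (Fin n → ℤ) := {x | ∀ i, 0 ≤ x i ∧ x i ≤ u i}

/-- The sequence of pairs `(a i, u i)` is weakly superincreasing. For the first index the sum is
empty, so that nothing beyond `0 ≤ a i` is asked there. -/
def Superincreasing {n : ℕ} (a u : Fin n → ℤ) : Prop :=
  ∀ i, ∑ k ∈ Finset.Iio i, a k * u k ≤ a i

/-- The knapsack `a ⬝ᵥ x ≤ b` over the box. -/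
def knapsackLE {n : ℕ} (a u : Fin n → ℤ) (b : ℤ) : Set (Fin n → ℤ) := {x ∈ box u | a ⬝ᵥ x ≤ b}

/-- The knapsack `w ⬝ᵥ x ≥ d` over the box. -/
def knapsackGE {n : ℕ} (w u : Fin n → ℤ) (d : ℤ) : Set (Fin n → ℤ) := {x ∈ box u | d ≤ w ⬝ᵥ x}

/-- The lexicographic order that compares the entries starting from the last one: `x = y`, or
`x i < y i` at the largest index `i` with `x i ≠ y i`. -/
def LexLE {n : ℕ} (x y : Fin n → ℤ) : Prop := toColex x ≤ toColex y

/-- `LexLE` spelled out in coordinates. -/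
theorem lexLE_iff {n : ℕ} (x y : Fin n → ℤ) :
    LexLE x y ↔ x = y ∨ ∃ i, x i < y i ∧ ∀ j, i < j → x j = y j := by
  unfold LexLE
  rw [le_iff_eq_or_lt, toColex_inj]
  refine or_congr Iff.rfl ?_
  constructor
  · rintro ⟨i, h, hi⟩
    exact ⟨i, hi, fun j hj => h j hj⟩
  · rintro ⟨i, hi, h⟩
    exact ⟨i, fun j hj => h j hj, hi⟩

/-- The greedy solution of the knapsack `a ⬝ᵥ x ≤ b` over the box, computed from the last index
down to the first one; `/` is division of integers rounded down (for positive divisors). -/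
def greedy {n : ℕ} (a u : Fin n → ℤ) (b : ℤ) (i : Fin n) : ℤ :=
  min (u i) ((b - ∑ k : {k : Fin n // i < k}, a k * greedy a u b k) / a i)
termination_by n - (i : ℕ)
decreasing_by
  have _h1 : (i : ℕ) < ((k : Fin n) : ℕ) := k.2
  have _h2 : ((k : Fin n) : ℕ) < n := (k : Fin n).2
  omega

/-- The minimal packing of the knapsack `w ⬝ᵥ x ≥ d` over the box: the greedy solution after
complementing the variables, `x ↦ u - x`. -/
def minPacking {n : ℕ} (w u : Fin n → ℤ) (d : ℤ) (i : Fin n) : ℤ :=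
  u i - greedy w u (w ⬝ᵥ u - d) i

/-- The convex hull in `ℝ ^ n` of a set of integer vectors. -/
def conv {n : ℕ} (S : Set (Fin n → ℤ)) : Set (Fin n → ℝ) :=
  convexHull ℝ ((fun (x : Fin n → ℤ) (i : Fin n) => (x i : ℝ)) '' S)

/-- `P` is the solution set of a system of at most `N` linear inequalities `A k ⬝ᵥ x ≤ r k`. -/
def DescribedBy {n : ℕ} (P : Set (Fin n → ℝ)) (N : ℕ) : Prop :=
  ∃ m ≤ N, ∃ (A : Fin m → Fin n → ℝ) (r : Fin m → ℝ), P = {x | ∀ k, A k ⬝ᵥ x ≤ r k}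

end SuperincreasingKnapsack

namespace SuperincreasingKnapsack

/-! Superincreasing weights turn each knapsack into an initial or final lexicographic segment of the
box (`knapsackLE_eq`, `knapsackGE_eq`), so everything reduces to lexicographic intervals.

Read `x` from the last coordinate down. Let a part of weight `α` be bound to lie below `θ`, the rest
being free. Then `x_n ≤ α θ_n + (1 - α) u_n`, and the excess `x_n - (1 - α) u_n - α (θ_n - 1)`, if
positive, is the least weight that must tie with `θ_n` and stay bound; for `θ_n = 0` all of `α`
stays bound. Iterating gives the `n` affine inequalities `Feas`, with `s = α - 1`. No truncation at
weight `0` is needed: a nonpositive weight constrains nothing in the box (`feas_of_le_neg_one`). The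
reflection `x ↦ u - x` gives the system for `γ`.

Conversely, let `x` satisfy both systems. While `γ` and `θ` agree, the coordinates of `x` are
forced. Where they first differ, the bound weights satisfy `α + β ≤ 1`, and from there
`exists_decomposition` splits `x` into a part below `θ`, a part above `γ` and a free part. Thus the
intersection of the two hulls lies in `intervalPolytope`, which lies in the hull of the interval.
Any intersection of knapsacks is such an interval or empty. -/

/-! ### Lexicographic order and the box. -/

theorem lexLE_total {n : ℕ} (x y : Fin n → ℤ) : LexLE x y ∨ LexLE y x :=
  le_total (toColex x) (toColex y)

theorem LexLE.trans {n : ℕ} {x y z : Fin n → ℤ} (h : LexLE x y) (h' : LexLE y z) : LexLE x z :=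
  le_trans (α := Colex (Fin n → ℤ)) h h'

theorem lexLE_refl {n : ℕ} (x : Fin n → ℤ) : LexLE x x := le_refl (toColex x)

theorem exists_lt_of_not_lexLE {n : ℕ} {x y : Fin n → ℤ} (h : ¬ LexLE x y) :
    ∃ i, y i < x i ∧ ∀ j, i < j → y j = x j := by
  rcases (lexLE_iff y x).1 ((lexLE_total x y).resolve_left h) with rfl | h'
  · exact absurd (lexLE_refl y) h
  · exact h'

theorem lexLE_sub_left_iff {n : ℕ} (u x y : Fin n → ℤ) :
    LexLE (u - x) (u - y) ↔ LexLE y x := by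
  simp only [lexLE_iff, Pi.sub_apply, sub_right_inj, sub_lt_sub_iff_left]
  constructor
  · rintro (h | ⟨i, hi, h⟩)
    · exact Or.inl h.symm
    · exact Or.inr ⟨i, hi, fun j hj => (h j hj).symm⟩
  · rintro (h | ⟨i, hi, h⟩)
    · exact Or.inl h.symm
    · exact Or.inr ⟨i, hi, fun j hj => (h j hj).symm⟩

/-- The order is decided by the last entry, and by the remaining ones in case of a tie. -/
theorem lexLE_succ_iff {n : ℕ} (x y : Fin (n + 1) → ℤ) :
    LexLE x y ↔ x (Fin.last n) < y (Fin.last n) ∨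
      x (Fin.last n) = y (Fin.last n) ∧ LexLE (Fin.init x) (Fin.init y) := by
  simp only [lexLE_iff]
  constructor
  · rintro (rfl | ⟨i, hi, h⟩)
    · exact Or.inr ⟨rfl, Or.inl rfl⟩
    · induction i using Fin.lastCases with
      | last => exact Or.inl hi
      | cast i =>
        exact Or.inr ⟨h _ (Fin.castSucc_lt_last i),
          Or.inr ⟨i, hi, fun j hj => h _ (Fin.castSucc_lt_castSucc_iff.2 hj)⟩⟩
  · rintro (h | ⟨h0, h | ⟨i, hi, h⟩⟩)
    · exact Or.inr ⟨_, h, fun j hj => absurd (Fin.le_last j) (not_le.2 hj)⟩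
    · left
      rw [← Fin.snoc_init_self x, ← Fin.snoc_init_self y, h, h0]
    · refine Or.inr ⟨i.castSucc, hi, fun j hj => ?_⟩
      induction j using Fin.lastCases with
      | last => exact h0
      | cast j => exact h j (Fin.castSucc_lt_castSucc_iff.1 hj)

theorem init_mem_box {n : ℕ} {u x : Fin (n + 1) → ℤ} (h : x ∈ box u) :
    Fin.init x ∈ box (Fin.init u) := fun i => h i.castSucc

theorem snoc_mem_box {n : ℕ} {u : Fin (n + 1) → ℤ} {z : Fin n → ℤ} {k : ℤ}
    (hz : z ∈ box (Fin.init u)) (h0 : 0 ≤ k) (hk : k ≤ u (Fin.last n)) :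
    Fin.snoc (α := fun _ => ℤ) z k ∈ box u := by
  intro i
  induction i using Fin.lastCases with
  | last => simpa using ⟨h0, hk⟩
  | cast i => simpa [Fin.init] using hz i

theorem sub_mem_box_iff {n : ℕ} {u x : Fin n → ℤ} : u - x ∈ box u ↔ x ∈ box u := by
  refine forall_congr' fun i => ?_
  simp only [Pi.sub_apply]
  constructor <;> rintro ⟨h, h'⟩ <;> constructor <;> linarith

theorem box_finite {n : ℕ} (u : Fin n → ℤ) : (box u).Finite :=
  (Set.finite_Icc (0 : Fin n → ℤ) u).subset fun _ hx => ⟨fun i => (hx i).1, fun i => (hx i).2⟩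

/-! ### Knapsacks and the greedy solution -/

theorem greedy_eq {n : ℕ} (a u : Fin n → ℤ) (b : ℤ) (i : Fin n) :
    greedy a u b i = min (u i) ((b - ∑ k ∈ Finset.Ioi i, a k * greedy a u b k) / a i) := by
  rw [greedy]
  congr 3
  rw [← Finset.sum_subtype (Finset.Ioi i) (fun k => by simp) (fun k => a k * greedy a u b k)]

theorem dotProduct_eq_Iio_add_Ioi {n : ℕ} (a x : Fin n → ℤ) (i : Fin n) :
    a ⬝ᵥ x = ∑ k ∈ Finset.Iio i, a k * x k + a i * x i + ∑ k ∈ Finset.Ioi i, a k * x k := by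
  have h : (Finset.univ : Finset (Fin n)) = (Finset.Iio i ∪ {i}) ∪ Finset.Ioi i := by
    ext k
    simp only [Finset.mem_univ, Finset.mem_union, Finset.mem_Iio, Finset.mem_singleton,
      Finset.mem_Ioi, true_iff]
    rcases lt_trichotomy k i with h | h | h <;> tauto
  rw [dotProduct, h, Finset.sum_union, Finset.sum_union, Finset.sum_singleton]
  · simp
  · rw [Finset.disjoint_left]
    intro k hk hk'
    simp only [Finset.mem_union, Finset.mem_Iio, Finset.mem_singleton, Finset.mem_Ioi] at hk hk'
    rcases hk with h | h
    · exact lt_asymm h hk'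
    · exact hk'.ne' h

/-- Tails `j ≤ k` cover both the whole sum (`j = 0`) and the sum strictly above `i` (`j = i + 1`).
Rounding down keeps each new term within the remaining capacity. -/
theorem greedy_residual_nonneg {n : ℕ} {a u : Fin n → ℤ} {b : ℤ} (ha : ∀ i, 0 < a i)
    (hb : 0 ≤ b) (m j : ℕ) (hj : n ≤ j + m) :
    ∑ k with j ≤ (k : Fin n).val, a k * greedy a u b k ≤ b := by
  induction m generalizing j with
  | zero =>
    refine (Finset.sum_eq_zero fun k hk => ?_).trans_le hb
    have := (Finset.mem_filter.1 hk).2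
    omega
  | succ m ih =>
    have ih' := ih (j + 1) (by omega)
    by_cases hjn : j < n
    · let i : Fin n := ⟨j, hjn⟩
      have h1 : (Finset.univ.filter fun k : Fin n => j ≤ k.val) = insert i (Finset.Ioi i) := by
        ext k
        simp only [Finset.mem_filter, Finset.mem_univ, true_and, Finset.mem_insert,
          Finset.mem_Ioi, Fin.ext_iff, Fin.lt_def, i]
        omega
      have h2 : (Finset.univ.filter fun k : Fin n => j + 1 ≤ k.val) = Finset.Ioi i := by
        ext k
        simp only [Finset.mem_filter, Finset.mem_univ, true_and, Finset.mem_Ioi, Fin.lt_def, i]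
        omega
      rw [h1, Finset.sum_insert (by simp)]
      rw [h2] at ih'
      have h3 : greedy a u b i ≤ (b - ∑ k ∈ Finset.Ioi i, a k * greedy a u b k) / a i := by
        rw [greedy_eq]
        exact min_le_right _ _
      have h4 := (Int.le_ediv_iff_mul_le (ha i)).1 h3
      linarith
    · have h1 : (Finset.univ.filter fun k : Fin n => j ≤ k.val) = ∅ := by
        ext k
        simp only [Finset.mem_filter, Finset.mem_univ, true_and, Finset.notMem_empty, iff_false]
        omega
      rw [h1]
      simpa using hb

theorem dotProduct_greedy_le {n : ℕ} {a u : Fin n → ℤ} {b : ℤ} (ha : ∀ i, 0 < a i)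
    (hb : 0 ≤ b) : a ⬝ᵥ greedy a u b ≤ b := by
  simpa [dotProduct] using greedy_residual_nonneg (u := u) ha hb n 0 (by omega)

theorem greedy_mem_box {n : ℕ} {a u : Fin n → ℤ} {b : ℤ} (ha : ∀ i, 0 < a i)
    (hu : ∀ i, 0 < u i) (hb : 0 ≤ b) : greedy a u b ∈ box u := by
  intro i
  rw [greedy_eq]
  refine ⟨le_min (hu i).le (Int.ediv_nonneg ?_ (ha i).le), min_le_left _ _⟩
  have h := greedy_residual_nonneg (u := u) ha hb n (i + 1) (by omega)
  have h2 : (Finset.univ.filter fun k : Fin n => i.val + 1 ≤ k.val) = Finset.Ioi i := by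
    ext k
    simp only [Finset.mem_filter, Finset.mem_univ, true_and, Finset.mem_Ioi, Fin.lt_def]
    omega
  rw [h2] at h
  linarith

/-- Exceeding the greedy vector at the top differing entry exceeds the floor there, hence the
capacity. Falling below it saves at least `a i`, which pays for all lower entries. -/
theorem knapsackLE_eq {n : ℕ} {a u : Fin n → ℤ} {b : ℤ} (hn : 0 < n) (hu : ∀ i, 0 < u i)
    (ha : ∀ i, 0 < a i) (hs : Superincreasing a u) :
    knapsackLE a u b = {x ∈ box u | LexLE x (greedy a u b)} := by
  ext x
  refine and_congr_right fun hx => ⟨fun hxb => ?_, fun hle => ?_⟩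
  · by_contra hlex
    obtain ⟨i, hi, hj⟩ := exists_lt_of_not_lexLE hlex
    have hsum : ∑ k ∈ Finset.Ioi i, a k * greedy a u b k = ∑ k ∈ Finset.Ioi i, a k * x k :=
      Finset.sum_congr rfl fun k hk => by rw [hj k (Finset.mem_Ioi.1 hk)]
    have hlow : 0 ≤ ∑ k ∈ Finset.Iio i, a k * x k :=
      Finset.sum_nonneg fun k _ => mul_nonneg (ha k).le (hx k).1
    rw [greedy_eq, min_lt_iff, hsum] at hi
    have h1 := hi.resolve_left (not_lt.2 (hx i).2)
    have h2 := (Int.ediv_lt_iff_lt_mul (ha i)).1 h1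
    rw [dotProduct_eq_Iio_add_Ioi a x i] at hxb
    linarith
  · rcases lt_or_ge b 0 with hb | hb
    -- Negative capacity arises by complementing an empty `≥`-knapsack. The last greedy entry is
    -- then negative, so no box vector lies below.
    · exfalso
      obtain ⟨m, rfl⟩ : ∃ m, n = m + 1 := ⟨n - 1, by omega⟩
      have h1 : x (Fin.last m) ≤ greedy a u b (Fin.last m) := by
        rcases (lexLE_succ_iff _ _).1 hle with h | h
        · exact h.le
        · exact h.1.le
      have h2 : greedy a u b (Fin.last m) ≤ b / a (Fin.last m) := by
        have h := greedy_eq a u b (Fin.last m)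
        have h3 : Finset.Ioi (Fin.last m) = ∅ := by
          ext k
          simpa using Fin.le_last k
        rw [h3, Finset.sum_empty, sub_zero] at h
        rw [h]
        exact min_le_right _ _
      have h3 := Int.ediv_lt_of_lt_mul (a := b) (b := 0) (ha (Fin.last m)) (by simpa using hb)
      have h4 := (hx (Fin.last m)).1
      omega
    · have hg := dotProduct_greedy_le (u := u) ha hb
      have hgb := greedy_mem_box ha hu hb
      rcases (lexLE_iff _ _).1 hle with h | ⟨i, hi, hj⟩
      · rw [h]
        exact hg
      · have hsum : ∑ k ∈ Finset.Ioi i, a k * greedy a u b k = ∑ k ∈ Finset.Ioi i, a k * x k :=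
          Finset.sum_congr rfl fun k hk => by rw [hj k (Finset.mem_Ioi.1 hk)]
        have hlow : 0 ≤ ∑ k ∈ Finset.Iio i, a k * greedy a u b k :=
          Finset.sum_nonneg fun k _ => mul_nonneg (ha k).le (hgb k).1
        have hup : ∑ k ∈ Finset.Iio i, a k * x k ≤ a i :=
          (Finset.sum_le_sum fun k _ => mul_le_mul_of_nonneg_left (hx k).2 (ha k).le).trans (hs i)
        have hmid : a i * (x i + 1) ≤ a i * greedy a u b i :=
          mul_le_mul_of_nonneg_left hi (ha i).le
        rw [dotProduct_eq_Iio_add_Ioi a _ i] at hg ⊢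
        linarith

theorem mem_knapsackGE_iff {n : ℕ} {w u : Fin n → ℤ} {d : ℤ} {x : Fin n → ℤ} :
    x ∈ knapsackGE w u d ↔ u - x ∈ knapsackLE w u (w ⬝ᵥ u - d) := by
  refine and_congr sub_mem_box_iff.symm ?_
  rw [dotProduct_sub]
  constructor <;> intro h <;> linarith

theorem minPacking_eq {n : ℕ} (w u : Fin n → ℤ) (d : ℤ) :
    minPacking w u d = u - greedy w u (w ⬝ᵥ u - d) := rfl

theorem knapsackGE_eq {n : ℕ} {w u : Fin n → ℤ} {d : ℤ} (hn : 0 < n) (hu : ∀ i, 0 < u i)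
    (hw : ∀ i, 0 < w i) (hs : Superincreasing w u) :
    knapsackGE w u d = {x ∈ box u | LexLE (minPacking w u d) x} := by
  ext x
  rw [mem_knapsackGE_iff, knapsackLE_eq hn hu hw hs, minPacking_eq]
  refine and_congr sub_mem_box_iff ?_
  rw [← lexLE_sub_left_iff u, sub_sub_cancel]

theorem minPacking_mem_box {n : ℕ} {w u : Fin n → ℤ} {d : ℤ} (hu : ∀ i, 0 < u i)
    (hw : ∀ i, 0 < w i) (h : (knapsackGE w u d).Nonempty) : minPacking w u d ∈ box u := by
  obtain ⟨x, hx⟩ := h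
  rw [minPacking_eq, sub_mem_box_iff]
  refine greedy_mem_box hw hu ?_
  have hxu : w ⬝ᵥ x ≤ w ⬝ᵥ u :=
    Finset.sum_le_sum fun k _ => mul_le_mul_of_nonneg_left (hx.1 k).2 (hw k).le
  linarith [hx.2]

/-! ### Convex hulls of integer sets -/

theorem conv_mono {n : ℕ} {S T : Set (Fin n → ℤ)} (h : S ⊆ T) : conv S ⊆ conv T :=
  convexHull_mono (Set.image_mono h)

theorem cast_mem_conv {n : ℕ} {S : Set (Fin n → ℤ)} {z : Fin n → ℤ} (hz : z ∈ S) :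
    (fun i => (z i : ℝ)) ∈ conv S := subset_convexHull ℝ _ ⟨z, hz, rfl⟩

theorem convex_conv {n : ℕ} (S : Set (Fin n → ℤ)) : Convex ℝ (conv S) := convex_convexHull ℝ _

theorem conv_subset {n : ℕ} {S : Set (Fin n → ℤ)} {P : Set (Fin n → ℝ)} (hP : Convex ℝ P)
    (h : ∀ z ∈ S, (fun i => (z i : ℝ)) ∈ P) : conv S ⊆ P :=
  convexHull_min (by rintro _ ⟨z, hz, rfl⟩; exact h z hz) hP

theorem conv_empty {n : ℕ} : conv (∅ : Set (Fin n → ℤ)) = ∅ := by simp [conv]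

theorem snoc_combo {n : ℕ} (s t : ℝ) (x y : Fin n → ℝ) (a b : ℝ) :
    s • Fin.snoc (α := fun _ => ℝ) x a + t • Fin.snoc (α := fun _ => ℝ) y b =
      Fin.snoc (α := fun _ => ℝ) (s • x + t • y) (s * a + t * b) := by
  ext i
  induction i using Fin.lastCases <;> simp

theorem snoc_cast_mem_conv {n : ℕ} {S : Set (Fin n → ℤ)} {T : Set (Fin (n + 1) → ℤ)} {k : ℤ}
    {r : Fin n → ℝ} (hr : r ∈ conv S) (h : ∀ z ∈ S, Fin.snoc (α := fun _ => ℤ) z k ∈ T) :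
    Fin.snoc (α := fun _ => ℝ) r (k : ℝ) ∈ conv T := by
  refine conv_subset (P := {r | Fin.snoc (α := fun _ => ℝ) r (k : ℝ) ∈ conv T}) ?_ ?_ hr
  · intro x hx y hy s t hs ht hst
    have h1 := convex_conv T hx hy hs ht hst
    rw [snoc_combo, ← add_mul, hst, one_mul] at h1
    exact h1
  · intro z hz
    have h2 : Fin.snoc (α := fun _ => ℝ) (fun i => (z i : ℝ)) (k : ℝ) =
        fun i => ((Fin.snoc (α := fun _ => ℤ) z k : Fin (n + 1) → ℤ) i : ℝ) := by
      ext i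
      induction i using Fin.lastCases <;> simp
    rw [Set.mem_ofPred_eq, h2]
    exact cast_mem_conv (h z hz)

/-- If every point of `S` extends to `T` by each of two last entries, then every point of the
convex hull extends by every real number in between. -/
theorem snoc_mem_conv {n : ℕ} {S : Set (Fin n → ℤ)} {T : Set (Fin (n + 1) → ℤ)} {k l : ℤ}
    {r : Fin n → ℝ} (hr : r ∈ conv S) (hk : ∀ z ∈ S, Fin.snoc (α := fun _ => ℤ) z k ∈ T)
    (hl : ∀ z ∈ S, Fin.snoc (α := fun _ => ℤ) z l ∈ T)
    {t : ℝ} (h0 : 0 ≤ t) (h1 : t ≤ 1) :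
    Fin.snoc (α := fun _ => ℝ) r ((1 - t) * k + t * l) ∈ conv T := by
  have h := convex_conv T (snoc_cast_mem_conv hr hk) (snoc_cast_mem_conv hr hl)
    (sub_nonneg.2 h1) h0 (by ring)
  rw [snoc_combo, ← add_smul] at h
  simpa using h

/-- Merges two weighted points without normalising, so zero weights are allowed; `z` must lie in `P`
only if its weight is nonzero. -/
theorem exists_mem_convex_smul_eq {E : Type*} [AddCommGroup E] [Module ℝ E] {P : Set E}
    (hP : Convex ℝ P) {α α' : ℝ} {y z : E} (h0 : 0 ≤ α') (h1 : α' ≤ α) (hy : y ∈ P)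
    (hz : α' = α ∨ z ∈ P) : ∃ p ∈ P, α • p = α' • y + (α - α') • z := by
  rcases h1.eq_or_lt with rfl | hlt
  · exact ⟨y, hy, by simp⟩
  · have hα : 0 < α := h0.trans_lt hlt
    refine ⟨(α' / α) • y + ((α - α') / α) • z, hP hy (hz.resolve_left hlt.ne) (by positivity)
      (div_nonneg (sub_nonneg.2 h1) hα.le) (by field_simp; ring), ?_⟩
    rw [smul_add, smul_smul, smul_smul, mul_div_cancel₀ _ hα.ne', mul_div_cancel₀ _ hα.ne']

theorem exists_combo_eq {l r x : ℝ} (hl : l ≤ x) (hr : x ≤ r) :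
    ∃ t : ℝ, 0 ≤ t ∧ t ≤ 1 ∧ x = (1 - t) * l + t * r := by
  rcases (hl.trans hr).eq_or_lt with rfl | h
  · exact ⟨0, le_rfl, zero_le_one, by linarith⟩
  · have h' : 0 < r - l := sub_pos.2 h
    refine ⟨(x - l) / (r - l), div_nonneg (sub_nonneg.2 hl) h'.le,
      (div_le_one h').2 (by linarith), ?_⟩
    field_simp
    ring

/-! ### The system of linear inequalities -/

/-- The system describing the hull of the vectors of the box below `θ`, with a parameter `s`:
it is `0` for the hull itself, and `α - 1` if only a part of weight `α` of `x` has to be below `θ`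
while the rest is free in the box. -/
def Feas : {n : ℕ} → (u θ : Fin n → ℤ) → (x : Fin n → ℝ) → (s : ℝ) → Prop
  | 0, _, _, _, _ => True
  | n + 1, u, θ, x, s =>
    x (Fin.last n) - θ (Fin.last n) + (u (Fin.last n) - θ (Fin.last n)) * s ≤ 0 ∧
      Feas (Fin.init u) (Fin.init θ) (Fin.init x)
        -- With `s = α - 1`, the second branch is the tied weight minus `1`. For `θ_n = 0` nothing
        -- can drop below, so the weight is unchanged.
        (if θ (Fin.last n) = 0 then s
          else x (Fin.last n) - θ (Fin.last n) + (1 + u (Fin.last n) - θ (Fin.last n)) * s)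

/-- The real box. -/
def realBox {n : ℕ} (u : Fin n → ℤ) : Set (Fin n → ℝ) := {x | ∀ i, 0 ≤ x i ∧ x i ≤ u i}

/-- The reflection of the real vector `x` in the box. -/
def reflect {n : ℕ} (u : Fin n → ℤ) (x : Fin n → ℝ) : Fin n → ℝ := fun i => u i - x i

theorem init_mem_realBox {n : ℕ} {u : Fin (n + 1) → ℤ} {x : Fin (n + 1) → ℝ}
    (h : x ∈ realBox u) : Fin.init x ∈ realBox (Fin.init u) := fun i => h i.castSucc

theorem cast_mem_realBox {n : ℕ} {u z : Fin n → ℤ} (hz : z ∈ box u) :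
    (fun i => (z i : ℝ)) ∈ realBox u := fun i =>
  ⟨Int.cast_nonneg (hz i).1, Int.cast_le.2 (hz i).2⟩

theorem reflect_mem_realBox {n : ℕ} {u : Fin n → ℤ} {x : Fin n → ℝ} (h : x ∈ realBox u) :
    reflect u x ∈ realBox u := fun i =>
  ⟨sub_nonneg.2 (h i).2, by simpa [reflect] using (h i).1⟩

theorem feas_of_le_neg_one {n : ℕ} {u θ : Fin n → ℤ} {x : Fin n → ℝ} {s : ℝ}
    (hθ : θ ∈ box u) (hx : x ∈ realBox u) (hs : s ≤ -1) : Feas u θ x s := by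
  induction n generalizing s with
  | zero => trivial
  | succ n ih =>
    have h1 : (θ (Fin.last n) : ℝ) ≤ u (Fin.last n) := by exact_mod_cast (hθ (Fin.last n)).2
    have h2 := (hx (Fin.last n)).2
    refine ⟨by nlinarith, ih (init_mem_box hθ) (init_mem_realBox hx) ?_⟩
    split_ifs
    · exact hs
    · nlinarith

/-- Convex combinations need nonnegative weights, so the affine weight `1 + s` is replaced by its
positive part. -/
theorem feas_max {n : ℕ} {u θ : Fin n → ℤ} {x : Fin n → ℝ} {s : ℝ}
    (hθ : θ ∈ box u) (hx : x ∈ realBox u) (h : Feas u θ x s) :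
    Feas u θ x (max 0 (1 + s) - 1) := by
  rcases le_total 0 (1 + s) with h0 | h0
  · rw [max_eq_right h0, add_sub_cancel_left]
    exact h
  · rw [max_eq_left h0]
    exact feas_of_le_neg_one hθ hx (by norm_num)

/-- A strict drop below `θ` sends the parameter to `-1` or less; a tie keeps it nonpositive. -/
theorem feas_of_lexLE {n : ℕ} {u θ z : Fin n → ℤ} {s : ℝ} (hθ : θ ∈ box u) (hz : z ∈ box u)
    (hle : LexLE z θ) (hs : s ≤ 0) : Feas u θ (fun i => (z i : ℝ)) s := by
  induction n generalizing s with
  | zero => trivial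
  | succ n ih =>
    have h1 : (θ (Fin.last n) : ℝ) ≤ u (Fin.last n) := by exact_mod_cast (hθ (Fin.last n)).2
    rcases (lexLE_succ_iff z θ).1 hle with h | ⟨h, hi⟩
    · have h2 : (z (Fin.last n) : ℝ) + 1 ≤ θ (Fin.last n) := by exact_mod_cast h
      have h3 : θ (Fin.last n) ≠ 0 := by have := (hz (Fin.last n)).1; omega
      refine ⟨by nlinarith, ?_⟩
      rw [if_neg h3]
      exact feas_of_le_neg_one (init_mem_box hθ) (cast_mem_realBox (init_mem_box hz))
        (by nlinarith)
    · have h2 : (z (Fin.last n) : ℝ) = θ (Fin.last n) := by rw [h]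
      refine ⟨by nlinarith, ih (init_mem_box hθ) (init_mem_box hz) hi ?_⟩
      split_ifs
      · exact hs
      · nlinarith

/-- The system consists of `n` affine inequalities. -/
theorem exists_affine_feas {E : Type*} [AddCommGroup E] [Module ℝ E] {n : ℕ} (u θ : Fin n → ℤ)
    (g : Fin n → E →ᵃ[ℝ] ℝ) (s : E →ᵃ[ℝ] ℝ) :
    ∃ f : Fin n → E →ᵃ[ℝ] ℝ, ∀ x, Feas u θ (fun i => g i x) (s x) ↔ ∀ k, f k x ≤ 0 := by
  induction n generalizing s with
  | zero => exact ⟨g, fun x => by simp [Feas]⟩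
  | succ n ih =>
    obtain ⟨f, hf⟩ := ih (Fin.init u) (Fin.init θ) (Fin.init g)
      (if θ (Fin.last n) = 0 then s else g (Fin.last n) - AffineMap.const ℝ E (θ (Fin.last n) : ℝ)
        + (1 + u (Fin.last n) - θ (Fin.last n) : ℝ) • s)
    refine ⟨Fin.snoc (α := fun _ => E →ᵃ[ℝ] ℝ) f
      (g (Fin.last n) - AffineMap.const ℝ E (θ (Fin.last n) : ℝ)
        + (u (Fin.last n) - θ (Fin.last n) : ℝ) • s), fun x => ?_⟩
    rw [Fin.forall_fin_succ']
    simp only [Fin.snoc_last, Fin.snoc_castSucc]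
    rw [← hf x, Feas, and_comm]
    refine and_congr (iff_of_eq ?_) (by simp)
    congr 1
    split_ifs <;> simp

theorem convex_feas {n : ℕ} {u θ : Fin n → ℤ} {E : Type*} [AddCommGroup E] [Module ℝ E]
    (g : Fin n → E →ᵃ[ℝ] ℝ) : Convex ℝ {x | Feas u θ (fun i => g i x) 0} := by
  obtain ⟨f, hf⟩ := exists_affine_feas u θ g (AffineMap.const ℝ E 0)
  have h : {x | Feas u θ (fun i => g i x) 0} = ⋂ k, f k ⁻¹' Set.Iic 0 := by
    ext x
    simpa using hf x
  rw [h]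
  exact convex_iInter fun k => (convex_Iic 0).affine_preimage (f k)

/-- The coordinate functions as affine maps. -/
def coord {n : ℕ} (i : Fin n) : (Fin n → ℝ) →ᵃ[ℝ] ℝ := (LinearMap.proj i).toAffineMap

/-- The coordinates of the reflected vector as affine maps. -/
def reflectCoord {n : ℕ} (u : Fin n → ℤ) (i : Fin n) : (Fin n → ℝ) →ᵃ[ℝ] ℝ :=
  AffineMap.const ℝ _ (u i : ℝ) - coord i

theorem coord_apply {n : ℕ} (i : Fin n) (x : Fin n → ℝ) : coord i x = x i := rfl

theorem reflectCoord_apply {n : ℕ} (u : Fin n → ℤ) (i : Fin n) (x : Fin n → ℝ) :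
    reflectCoord u i x = reflect u x i := rfl

theorem convex_realBox {n : ℕ} (u : Fin n → ℤ) : Convex ℝ (realBox u) := by
  have h : realBox u = Set.Icc (0 : Fin n → ℝ) (fun i => (u i : ℝ)) := by
    ext x
    exact ⟨fun h => ⟨fun i => (h i).1, fun i => (h i).2⟩, fun h i => ⟨h.1 i, h.2 i⟩⟩
  rw [h]
  exact convex_Icc _ _

/-- The polytope cut out of the real box by the two systems. -/
def intervalPolytope {n : ℕ} (u γ θ : Fin n → ℤ) : Set (Fin n → ℝ) :=
  {x | x ∈ realBox u ∧ Feas u θ x 0 ∧ Feas u (u - γ) (reflect u x) 0}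

/-! ### Validity of the two systems on the hulls. -/

theorem conv_le_subset {n : ℕ} {u θ : Fin n → ℤ} (hθ : θ ∈ box u) :
    conv {x ∈ box u | LexLE x θ} ⊆ {x | x ∈ realBox u ∧ Feas u θ x 0} :=
  conv_subset ((convex_realBox u).inter (convex_feas coord)) fun _ hz =>
    ⟨cast_mem_realBox hz.1, feas_of_lexLE hθ hz.1 hz.2 le_rfl⟩

theorem conv_ge_subset {n : ℕ} {u γ : Fin n → ℤ} (hγ : γ ∈ box u) :
    conv {x ∈ box u | LexLE γ x} ⊆ {x | Feas u (u - γ) (reflect u x) 0} :=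
  conv_subset (convex_feas (reflectCoord u)) fun z hz => by
    have h := feas_of_lexLE (sub_mem_box_iff.2 hγ) (sub_mem_box_iff.2 hz.1)
      ((lexLE_sub_left_iff u z γ).2 hz.2) le_rfl
    have h2 : (fun i => ((u - z) i : ℝ)) = reflect u (fun i => (z i : ℝ)) := by
      ext i
      simp [reflect]
    rwa [h2] at h

theorem conv_ge_inter_conv_le_subset {n : ℕ} {u γ θ : Fin n → ℤ} (hγ : γ ∈ box u)
    (hθ : θ ∈ box u) :
    conv {x ∈ box u | LexLE γ x} ∩ conv {x ∈ box u | LexLE x θ} ⊆ intervalPolytope u γ θ :=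
  fun _ hx => ⟨(conv_le_subset hθ hx.2).1, (conv_le_subset hθ hx.2).2, conv_ge_subset hγ hx.1⟩

/-- How the weights `α` and `β` of the parts tied to `θ` and to `γ` pass from one coordinate to the
next one, and the range of values of the coordinate that this leaves. -/
theorem exists_weights {u θ γ : ℤ} (hθ0 : 0 ≤ θ) (hθu : θ ≤ u) (hγ0 : 0 ≤ γ) (hγu : γ ≤ u)
    {α β x s t : ℝ} (hα : 0 ≤ α) (hβ : 0 ≤ β) (hαβ : α + β ≤ 1)
    (hs : s = if θ = 0 then α - 1 else x - θ + (1 + u - θ) * (α - 1))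
    (ht : t = if u - γ = 0 then β - 1 else γ - x + (1 + γ) * (β - 1))
    (h1 : x ≤ (1 - α) * u + α * θ) (h2 : β * γ ≤ x) :
    ∃ a b : ℝ, a = max 0 (1 + s) ∧ b = max 0 (1 + t) ∧ a ≤ α ∧ b ≤ β ∧
      (θ = 0 → a = α) ∧ (γ = u → b = β) ∧
      a * θ + b * γ + (β - b) * (γ + 1) ≤ x ∧
      x ≤ a * θ + (α - a) * (θ - 1) + b * γ + (β - b) * u + (1 - α - β) * u := by
  refine ⟨_, _, rfl, rfl, ?_⟩
  have hu0 : (0 : ℝ) ≤ u := by exact_mod_cast hθ0.trans hθu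
  have hfree : 0 ≤ (1 - α - β) * u := mul_nonneg (by linarith) hu0
  have hγ0' : (0 : ℝ) ≤ γ := by exact_mod_cast hγ0
  have hθu' : (θ : ℝ) ≤ u := by exact_mod_cast hθu
  by_cases hθ : θ = 0
  · subst hθ
    rw [if_pos rfl] at hs
    have ha : max 0 (1 + s) = α := by rw [hs, add_sub_cancel, max_eq_right hα]
    rw [ha]
    simp only [Int.cast_zero, mul_zero, add_zero, zero_add] at h1 ⊢
    by_cases hγ : γ = u
    · subst hγ
      rw [if_pos (sub_self _)] at ht
      have hb : max 0 (1 + t) = β := by rw [ht, add_sub_cancel, max_eq_right hβ]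
      rw [hb]
      exact ⟨le_rfl, le_rfl, fun _ => trivial, fun _ => rfl, by linarith, by linarith⟩
    · have hγ1 : (γ : ℝ) + 1 ≤ u := by exact_mod_cast lt_of_le_of_ne hγu hγ
      rw [if_neg (sub_ne_zero.2 (Ne.symm hγ))] at ht
      rcases le_total 0 (1 + t) with h | h
      · rw [max_eq_right h]
        generalize hb : 1 + t = b at *
        have hb' : b = β * (γ + 1) - x := by rw [← hb, ht]; ring
        refine ⟨le_rfl, by linarith, fun _ => trivial, fun h => absurd h hγ, by linarith, ?_⟩
        have := mul_nonneg (sub_nonneg.2 hγ1) (sub_nonneg.2 h2)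
        subst hb'
        nlinarith
      · rw [max_eq_left h]
        exact ⟨le_rfl, hβ, fun _ => trivial, fun h => absurd h hγ, by linarith, by linarith⟩
  · have hθ1 : (1 : ℝ) ≤ θ := by exact_mod_cast lt_of_le_of_ne hθ0 (Ne.symm hθ)
    have hαθ := mul_nonneg hα (sub_nonneg.2 hθ1)
    rw [if_neg hθ] at hs
    by_cases hγ : γ = u
    · subst hγ
      rw [if_pos (sub_self _)] at ht
      have hb : max 0 (1 + t) = β := by rw [ht, add_sub_cancel, max_eq_right hβ]
      rw [hb]
      rcases le_total 0 (1 + s) with h | h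
      · rw [max_eq_right h]
        generalize ha : 1 + s = a at *
        have ha' : x = a + (1 - α) * γ + α * (θ - 1) := by rw [← ha, hs]; ring
        have haα : a ≤ α := by linarith
        have := mul_nonneg (sub_nonneg.2 haα) (sub_nonneg.2 hθ1)
        exact ⟨haα, le_rfl, fun h => absurd h hθ, fun _ => rfl, by linarith, by linarith⟩
      · rw [max_eq_left h]
        exact ⟨hα, le_rfl, fun h => absurd h hθ, fun _ => rfl, by linarith, by linarith⟩
    · have hγ1 : (γ : ℝ) + 1 ≤ u := by exact_mod_cast lt_of_le_of_ne hγu hγ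
      have hβγ := mul_nonneg hβ (sub_nonneg.2 hγ1)
      rw [if_neg (sub_ne_zero.2 (Ne.symm hγ))] at ht
      rcases le_total (1 + s) 0 with h | h <;> rcases le_total (1 + t) 0 with h' | h'
      · rw [max_eq_left h, max_eq_left h']
        exact ⟨hα, hβ, fun h => absurd h hθ, fun h => absurd h hγ, by linarith, by linarith⟩
      · rw [max_eq_left h, max_eq_right h']
        generalize hb : 1 + t = b at *
        have hb' : x = β * (γ + 1) - b := by rw [← hb, ht]; ring
        have hbβ : b ≤ β := by linarith
        have := mul_nonneg (sub_nonneg.2 hbβ) (sub_nonneg.2 hγ1)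
        exact ⟨hα, hbβ, fun h => absurd h hθ, fun h => absurd h hγ, by linarith, by linarith⟩
      · rw [max_eq_right h, max_eq_left h']
        generalize ha : 1 + s = a at *
        have ha' : x = a + (1 - α) * u + α * (θ - 1) := by rw [← ha, hs]; ring
        have haα : a ≤ α := by linarith
        have := mul_nonneg (sub_nonneg.2 haα) (sub_nonneg.2 hθ1)
        exact ⟨haα, hβ, fun h => absurd h hθ, fun h => absurd h hγ, by linarith, by linarith⟩
      -- Here `(1 - α) u + α (θ - 1) ≤ x ≤ β (γ + 1) ≤ β u ≤ (1 - α) u`, so both excesses vanish.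
      · have hs0 : 1 + s = 0 := by linarith
        have ht0 : 1 + t = 0 := by linarith
        rw [hs0, ht0, max_self]
        exact ⟨hα, hβ, fun h => absurd h hθ, fun h => absurd h hγ, by linarith, by linarith⟩

/-! ### Decomposing the points of the polytope. -/

/-- Tied parts take the last entry `θ_n` or `γ_n`. The parts released from `θ` and `γ` range over
`[0, θ_n - 1]` and `[γ_n + 1, u_n]`, the free part over `[0, u_n]`. All of these share the same `r`
in the lower coordinates. -/
theorem exists_decomposition {n : ℕ} {u γ θ : Fin n → ℤ} (hγ : γ ∈ box u) (hθ : θ ∈ box u)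
    {x : Fin n → ℝ} (hx : x ∈ realBox u) {α β : ℝ} (hα : 0 ≤ α) (hβ : 0 ≤ β) (hαβ : α + β ≤ 1)
    (h1 : Feas u θ x (α - 1)) (h2 : Feas u (u - γ) (reflect u x) (β - 1)) :
    ∃ p ∈ conv {z ∈ box u | LexLE z θ}, ∃ q ∈ conv {z ∈ box u | LexLE γ z}, ∃ r ∈ conv (box u),
      x = α • p + β • q + (1 - α - β) • r := by
  induction n generalizing α β with
  | zero =>
    exact ⟨_, cast_mem_conv ⟨hθ, lexLE_refl θ⟩, _, cast_mem_conv ⟨hγ, lexLE_refl γ⟩, _,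
      cast_mem_conv hθ, Subsingleton.elim _ _⟩
  | succ n ih =>
    obtain ⟨h1l, h1i⟩ := h1
    obtain ⟨h2l, h2i⟩ := h2
    have hθl := hθ (Fin.last n)
    have hγl := hγ (Fin.last n)
    simp only [reflect, Pi.sub_apply, Int.cast_sub] at h2l h2i
    obtain ⟨a, b, ha, hb, haα, hbβ, haθ, hbγ, hlow, hupp⟩ :=
      exists_weights hθl.1 hθl.2 hγl.1 hγl.2 hα hβ hαβ rfl rfl
        (x := x (Fin.last n)) (by linarith) (by linarith)
    have h1' := feas_max (init_mem_box hθ) (init_mem_realBox hx) h1i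
    have h2' := feas_max (θ := Fin.init u - Fin.init γ) (x := reflect (Fin.init u) (Fin.init x))
      (sub_mem_box_iff.2 (init_mem_box hγ)) (reflect_mem_realBox (init_mem_realBox hx)) h2i
    rw [← ha] at h1'
    have hb' : b = max 0 (1 + if u (Fin.last n) - γ (Fin.last n) = 0 then β - 1
        else (u (Fin.last n) : ℝ) - x (Fin.last n) - (u (Fin.last n) - γ (Fin.last n)) +
          (1 + u (Fin.last n) - (u (Fin.last n) - γ (Fin.last n))) * (β - 1)) := by
      rw [hb]
      congr 3
      ring
    rw [← hb'] at h2'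
    have ha0 : 0 ≤ a := ha ▸ le_max_left _ _
    have hb0 : 0 ≤ b := hb ▸ le_max_left _ _
    obtain ⟨p, hp, q, hq, r, hr, hpqr⟩ := ih (init_mem_box hγ) (init_mem_box hθ)
      (init_mem_realBox hx) ha0 hb0 (by linarith) h1' h2'
    -- One ratio `t` places every untied part within its own range, and their total sweeps the
    -- interval given by `exists_weights`.
    obtain ⟨t, ht0, ht1, ht⟩ := exists_combo_eq hlow hupp
    set k : ℤ := θ (Fin.last n) with hk
    set l : ℤ := γ (Fin.last n) with hl
    set v : ℤ := u (Fin.last n) with hv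
    obtain ⟨p', hp', hpe⟩ := exists_mem_convex_smul_eq (convex_conv {z ∈ box u | LexLE z θ})
      (y := Fin.snoc (α := fun _ => ℝ) p (k : ℝ))
      (z := Fin.snoc (α := fun _ => ℝ) r ((1 - t) * (0 : ℤ) + t * (k - 1 : ℤ))) ha0 haα
      (snoc_cast_mem_conv hp (fun z hz => ⟨snoc_mem_box hz.1 hθl.1 hθl.2,
        (lexLE_succ_iff _ _).2 (Or.inr ⟨by simp [hk], by simpa using hz.2⟩)⟩))
      (by
        by_cases hk0 : k = 0
        · exact Or.inl (haθ hk0)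
        · right
          refine snoc_mem_conv hr (fun z hz => ?_) (fun z hz => ?_) ht0 ht1
          · refine ⟨snoc_mem_box hz le_rfl (hθl.1.trans hθl.2), (lexLE_succ_iff _ _).2 (Or.inl ?_)⟩
            simp only [Fin.snoc_last]
            omega
          · refine ⟨snoc_mem_box hz (by omega) (by omega), (lexLE_succ_iff _ _).2 (Or.inl ?_)⟩
            simp only [Fin.snoc_last]
            omega)
    obtain ⟨q', hq', hqe⟩ := exists_mem_convex_smul_eq (convex_conv {z ∈ box u | LexLE γ z})
      (y := Fin.snoc (α := fun _ => ℝ) q (l : ℝ))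
      (z := Fin.snoc (α := fun _ => ℝ) r ((1 - t) * (l + 1 : ℤ) + t * (v : ℤ))) hb0 hbβ
      (snoc_cast_mem_conv hq (fun z hz => ⟨snoc_mem_box hz.1 hγl.1 hγl.2,
        (lexLE_succ_iff _ _).2 (Or.inr ⟨by simp [hl], by simpa using hz.2⟩)⟩))
      (by
        by_cases hk0 : l = v
        · exact Or.inl (hbγ hk0)
        · right
          refine snoc_mem_conv hr (fun z hz => ?_) (fun z hz => ?_) ht0 ht1
          · refine ⟨snoc_mem_box hz (by omega) (by omega), (lexLE_succ_iff _ _).2 (Or.inl ?_)⟩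
            simp only [Fin.snoc_last]
            omega
          · refine ⟨snoc_mem_box hz (by omega) le_rfl, (lexLE_succ_iff _ _).2 (Or.inl ?_)⟩
            simp only [Fin.snoc_last]
            omega)
    have hr' : Fin.snoc (α := fun _ => ℝ) r ((1 - t) * (0 : ℤ) + t * (v : ℤ)) ∈ conv (box u) :=
      snoc_mem_conv hr (fun z hz => snoc_mem_box hz le_rfl (hθl.1.trans hθl.2))
        (fun z hz => snoc_mem_box hz (hθl.1.trans hθl.2) le_rfl) ht0 ht1
    refine ⟨p', hp', q', hq', _, hr', ?_⟩
    rw [hpe, hqe]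
    ext i
    induction i using Fin.lastCases with
    | last =>
      simp only [Pi.add_apply, Pi.smul_apply, Fin.snoc_last, smul_eq_mul]
      rw [ht]
      push_cast
      ring
    | cast i =>
      have h := congrFun hpqr i
      simp only [Pi.add_apply, Pi.smul_apply, Fin.snoc_castSucc, smul_eq_mul, Fin.init] at h ⊢
      rw [h]
      ring

theorem intervalPolytope_subset {n : ℕ} {u γ θ : Fin n → ℤ} (hγ : γ ∈ box u) (hθ : θ ∈ box u)
    (hle : LexLE γ θ) :
    intervalPolytope u γ θ ⊆ conv {x ∈ box u | LexLE γ x ∧ LexLE x θ} := by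
  induction n with
  | zero =>
    intro x _
    rw [Subsingleton.elim x fun i => (θ i : ℝ)]
    exact cast_mem_conv ⟨hθ, hle, lexLE_refl θ⟩
  | succ n ih =>
    rintro x ⟨hx, ⟨h1l, h1i⟩, ⟨h2l, h2i⟩⟩
    have hθl := hθ (Fin.last n)
    have hγl := hγ (Fin.last n)
    simp only [reflect, Pi.sub_apply, Int.cast_sub, mul_zero, add_zero] at h1l h1i h2l h2i
    have hxs : x = Fin.snoc (α := fun _ => ℝ) (Fin.init x) (x (Fin.last n)) :=
      (Fin.snoc_init_self x).symm
    set k : ℤ := θ (Fin.last n) with hk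
    set l : ℤ := γ (Fin.last n) with hl
    set v : ℤ := u (Fin.last n) with hv
    rcases (lexLE_succ_iff _ _).1 hle with hlt | ⟨heq, hi⟩
    · have hlt' : (l : ℝ) + 1 ≤ k := by exact_mod_cast hlt
      rw [if_neg (by omega)] at h1i h2i
      set y : ℝ := x (Fin.last n) with hy
      have h1' := feas_max (init_mem_box hθ) (init_mem_realBox hx) h1i
      have h2' := feas_max (θ := Fin.init u - Fin.init γ)
        (x := reflect (Fin.init u) (Fin.init x))
        (sub_mem_box_iff.2 (init_mem_box hγ)) (reflect_mem_realBox (init_mem_realBox hx)) h2i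
      set α : ℝ := max 0 (1 + (y - k)) with hα
      set β : ℝ := max 0 (1 + (v - y - (v - l))) with hβ
      have hα0 : 0 ≤ α := le_max_left _ _
      have hβ0 : 0 ≤ β := le_max_left _ _
      -- The untied rest has last entry in `[l + 1, k - 1]`, strictly between `γ` and `θ`; this
      -- range is empty for `k = l + 1`, so the rest must then have weight `0`.
      have key : α + β ≤ 1 ∧ ∃ t : ℝ, 0 ≤ t ∧ t ≤ 1 ∧
          y = α * k + β * l + (1 - α - β) * ((1 - t) * (l + 1) + t * (k - 1)) ∧
          (l + 1 = k → 1 - α - β = 0) := by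
        rcases le_total (1 + (y - k)) 0 with h | h <;>
          rcases le_total (1 + (v - y - (v - l))) 0 with h' | h'
        · rw [max_eq_left h] at hα
          rw [max_eq_left h'] at hβ
          obtain ⟨t, ht0, ht1, ht⟩ := exists_combo_eq (l := (l : ℝ) + 1) (r := k - 1) (x := y)
            (by linarith) (by linarith)
          refine ⟨by rw [hα, hβ]; norm_num, t, ht0, ht1, by rw [hα, hβ, ← ht]; ring, fun e => ?_⟩
          have : (l : ℝ) + 1 = k := by exact_mod_cast e
          linarith
        · rw [max_eq_left h] at hα
          rw [max_eq_right h'] at hβ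
          refine ⟨by rw [hα, hβ]; linarith, 0, le_rfl, zero_le_one, by rw [hα, hβ]; ring,
            fun e => ?_⟩
          have : (l : ℝ) + 1 = k := by exact_mod_cast e
          linarith
        · rw [max_eq_right h] at hα
          rw [max_eq_left h'] at hβ
          refine ⟨by rw [hα, hβ]; linarith, 1, zero_le_one, le_rfl, by rw [hα, hβ]; ring,
            fun e => ?_⟩
          have : (l : ℝ) + 1 = k := by exact_mod_cast e
          linarith
        · rw [max_eq_right h] at hα
          rw [max_eq_right h'] at hβ
          refine ⟨by rw [hα, hβ]; linarith, 0, le_rfl, zero_le_one, ?_, fun e => ?_⟩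
          -- Both weights nonnegative force `k ≤ l + 2`: then `α + β = 1` for `k = l + 1`, and `α =
          -- β = 0` for `k = l + 2`.
          · have h2 : k < l + 3 := by
              have : (k : ℝ) < l + 3 := by linarith
              exact_mod_cast this
            rcases (by omega : k = l + 1 ∨ k = l + 2) with e | e
            · have : (k : ℝ) = l + 1 := by exact_mod_cast e
              rw [hα, hβ, this]
              ring
            · have : (k : ℝ) = l + 2 := by exact_mod_cast e
              have hy1 : y = l + 1 := by linarith
              rw [hα, hβ, this, hy1]
              ring
          · have : (l : ℝ) + 1 = k := by exact_mod_cast e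
            linarith
      obtain ⟨hαβ, t, ht0, ht1, ht, hdeg⟩ := key
      obtain ⟨p, hp, q, hq, r, hr, hpqr⟩ := exists_decomposition (init_mem_box hγ)
        (init_mem_box hθ) (init_mem_realBox hx) hα0 hβ0 hαβ h1' h2'
      have hp' : Fin.snoc (α := fun _ => ℝ) p (k : ℝ) ∈
          conv {x ∈ box u | LexLE γ x ∧ LexLE x θ} :=
        snoc_cast_mem_conv hp (fun z hz => ⟨snoc_mem_box hz.1 hθl.1 hθl.2,
          (lexLE_succ_iff _ _).2 (Or.inl (by simpa using hlt)),
          (lexLE_succ_iff _ _).2 (Or.inr ⟨by simp [hk], by simpa using hz.2⟩)⟩)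
      have hq' : Fin.snoc (α := fun _ => ℝ) q (l : ℝ) ∈
          conv {x ∈ box u | LexLE γ x ∧ LexLE x θ} :=
        snoc_cast_mem_conv hq (fun z hz => ⟨snoc_mem_box hz.1 hγl.1 hγl.2,
          (lexLE_succ_iff _ _).2 (Or.inr ⟨by simp [hl], by simpa using hz.2⟩),
          (lexLE_succ_iff _ _).2 (Or.inl (by simpa using hlt))⟩)
      obtain ⟨p₁, hp₁, hpe⟩ := exists_mem_convex_smul_eq
        (convex_conv {x ∈ box u | LexLE γ x ∧ LexLE x θ}) hα0
        (le_add_of_nonneg_right hβ0 : α ≤ α + β) hp' (Or.inr hq')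
      obtain ⟨p₂, hp₂, hpe₂⟩ := exists_mem_convex_smul_eq
        (convex_conv {x ∈ box u | LexLE γ x ∧ LexLE x θ}) (add_nonneg hα0 hβ0) hαβ hp₁
        (z := Fin.snoc (α := fun _ => ℝ) r ((1 - t) * (l + 1 : ℤ) + t * (k - 1 : ℤ)))
        (by
          by_cases e : l + 1 = k
          · left
            linarith [hdeg e]
          · right
            refine snoc_mem_conv hr (fun z hz => ?_) (fun z hz => ?_) ht0 ht1 <;>
            · refine ⟨snoc_mem_box hz (by omega) (by omega), ?_⟩
              simp only [lexLE_succ_iff, Fin.snoc_last]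
              omega)
      rw [one_smul] at hpe₂
      convert hp₂
      rw [hpe₂, hpe]
      ext i
      induction i using Fin.lastCases with
      | last =>
        simp only [Pi.add_apply, Pi.smul_apply, Fin.snoc_last, smul_eq_mul]
        rw [← hy, ht]
        push_cast
        ring
      | cast i =>
        have h := congrFun hpqr i
        simp only [Pi.add_apply, Pi.smul_apply, Fin.snoc_castSucc, smul_eq_mul, Fin.init] at h ⊢
        rw [h]
        ring
    · have heq' : (l : ℝ) = k := by exact_mod_cast heq
      have hxk : x (Fin.last n) = k := by linarith
      have hs : (if k = 0 then (0 : ℝ) else x (Fin.last n) - k) = 0 := by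
        rw [hxk]
        simp
      have ht : (if v - l = 0 then (0 : ℝ) else v - x (Fin.last n) - (v - l)) = 0 := by
        rw [hxk, heq']
        simp
      rw [hs] at h1i
      rw [ht] at h2i
      have h := ih (init_mem_box hγ) (init_mem_box hθ) hi ⟨init_mem_realBox hx, h1i, h2i⟩
      rw [hxs, hxk]
      exact snoc_cast_mem_conv h (fun z hz => ⟨snoc_mem_box hz.1 hθl.1 hθl.2,
        (lexLE_succ_iff _ _).2 (Or.inr ⟨by simpa using heq, by simpa using hz.2.1⟩),
        (lexLE_succ_iff _ _).2 (Or.inr ⟨by simp [hk], by simpa using hz.2.2⟩)⟩)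

/-- Disposes of reversed pairs: ties keep both parameters at `0`, so the first differing entry
satisfies `γ_i ≤ x_i ≤ θ_i`. -/
theorem lexLE_of_mem_intervalPolytope {n : ℕ} {u γ θ : Fin n → ℤ} {x : Fin n → ℝ}
    (h : x ∈ intervalPolytope u γ θ) : LexLE γ θ := by
  induction n with
  | zero => exact (lexLE_iff _ _).2 (Or.inl (Subsingleton.elim _ _))
  | succ n ih =>
    obtain ⟨hx, ⟨h1l, h1i⟩, ⟨h2l, h2i⟩⟩ := h
    simp only [reflect, Pi.sub_apply, Int.cast_sub, mul_zero, add_zero] at h1l h1i h2l h2i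
    have hle : γ (Fin.last n) ≤ θ (Fin.last n) := by
      have : (γ (Fin.last n) : ℝ) ≤ θ (Fin.last n) := by linarith
      exact_mod_cast this
    refine (lexLE_succ_iff _ _).2 (hle.lt_or_eq.imp_right fun heq => ⟨heq, ?_⟩)
    have heq' : (γ (Fin.last n) : ℝ) = θ (Fin.last n) := by exact_mod_cast heq
    have hxk : x (Fin.last n) = θ (Fin.last n) := by linarith
    rw [hxk, sub_self, ite_self] at h1i
    rw [hxk, heq', sub_self, ite_self] at h2i
    exact ih ⟨init_mem_realBox hx, h1i, h2i⟩

theorem conv_interval_subset {n : ℕ} (u γ θ : Fin n → ℤ) :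
    conv {x ∈ box u | LexLE γ x ∧ LexLE x θ} ⊆
      conv {x ∈ box u | LexLE γ x} ∩ conv {x ∈ box u | LexLE x θ} :=
  Set.subset_inter (conv_mono fun _ h => ⟨h.1, h.2.1⟩) (conv_mono fun _ h => ⟨h.1, h.2.2⟩)

theorem conv_interval_eq_inter {n : ℕ} {u γ θ : Fin n → ℤ} (hγ : γ ∈ box u) (hθ : θ ∈ box u) :
    conv {x ∈ box u | LexLE γ x ∧ LexLE x θ} =
      conv {x ∈ box u | LexLE γ x} ∩ conv {x ∈ box u | LexLE x θ} :=
  (conv_interval_subset u γ θ).antisymm fun _ hx =>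
    have h := conv_ge_inter_conv_le_subset hγ hθ hx
    intervalPolytope_subset hγ hθ (lexLE_of_mem_intervalPolytope h) h

theorem conv_interval_eq_intervalPolytope {n : ℕ} {u γ θ : Fin n → ℤ} (hγ : γ ∈ box u)
    (hθ : θ ∈ box u) :
    conv {x ∈ box u | LexLE γ x ∧ LexLE x θ} = intervalPolytope u γ θ :=
  ((conv_interval_subset u γ θ).trans (conv_ge_inter_conv_le_subset hγ hθ)).antisymm
    fun _ h => intervalPolytope_subset hγ hθ (lexLE_of_mem_intervalPolytope h) h

/-! ### The number of inequalities -/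

theorem describedBy_of_affine {n : ℕ} {ι : Type*} [Fintype ι] (f : ι → (Fin n → ℝ) →ᵃ[ℝ] ℝ) :
    DescribedBy {x | ∀ k, f k x ≤ 0} (Fintype.card ι) := by
  let e := Fintype.equivFin ι
  refine ⟨_, le_rfl, fun k i => (f (e.symm k)).linear (Pi.single i 1),
    fun k => - f (e.symm k) 0, ?_⟩
  have key : ∀ (g : (Fin n → ℝ) →ᵃ[ℝ] ℝ) (x : Fin n → ℝ),
      g x ≤ 0 ↔ (fun i => g.linear (Pi.single i 1)) ⬝ᵥ x ≤ - g 0 := by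
    intro g x
    have h1 : g x = g.linear x + g 0 := congrFun (AffineMap.decomp g) x
    have h2 : g.linear x = (fun i => g.linear (Pi.single i 1)) ⬝ᵥ x := by
      rw [LinearMap.pi_apply_eq_sum_univ g.linear x, dotProduct]
      refine Finset.sum_congr rfl fun i _ => ?_
      rw [smul_eq_mul, mul_comm]
      congr 2
      ext j
      simp [Pi.single_apply, eq_comm]
    rw [h1, h2]
    constructor <;> intro h <;> linarith
  ext x
  simp only [Set.mem_ofPred_eq, ← key]
  exact ⟨fun h k => h _, fun h k => by simpa using h (e k)⟩

theorem describedBy_intervalPolytope {n : ℕ} (u γ θ : Fin n → ℤ) :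
    DescribedBy (intervalPolytope u γ θ) (4 * n) := by
  obtain ⟨f, hf⟩ := exists_affine_feas u θ coord (AffineMap.const ℝ _ 0)
  obtain ⟨g, hg⟩ := exists_affine_feas u (u - γ) (reflectCoord u) (AffineMap.const ℝ _ 0)
  have h := describedBy_of_affine
    (Sum.elim (Sum.elim (fun i => - coord i) (fun i => - reflectCoord u i)) (Sum.elim f g))
  -- `2n` inequalities for the real box and `n` for each of the two systems.
  have hc : Fintype.card ((Fin n ⊕ Fin n) ⊕ (Fin n ⊕ Fin n)) = 4 * n := by
    simp only [Fintype.card_sum, Fintype.card_fin]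
    ring
  rw [hc] at h
  convert h using 1
  ext x
  simp only [Set.mem_ofPred_eq, Sum.forall, Sum.elim_inl, Sum.elim_inr, ← hf, ← hg]
  refine and_congr ?_ Iff.rfl
  rw [← forall_and]
  refine forall_congr' fun i => ?_
  simp [coord_apply, reflectCoord_apply, reflect]

theorem describedBy_empty {n : ℕ} : DescribedBy (∅ : Set (Fin n → ℝ)) 1 :=
  ⟨1, le_rfl, 0, fun _ => -1, by ext x; simp⟩

theorem DescribedBy.mono {n N M : ℕ} {P : Set (Fin n → ℝ)} (h : DescribedBy P N) (hNM : N ≤ M) :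
    DescribedBy P M := by
  obtain ⟨m, hm, h⟩ := h
  exact ⟨m, hm.trans hNM, h⟩

/-- A nonempty order-convex subset of the box is an interval of the box. -/
theorem exists_eq_interval {n : ℕ} {u : Fin n → ℤ} {S : Set (Fin n → ℤ)} (hS : S ⊆ box u)
    (hne : S.Nonempty)
    (hc : ∀ x ∈ S, ∀ y ∈ S, ∀ z ∈ box u, LexLE x z → LexLE z y → z ∈ S) :
    ∃ γ ∈ box u, ∃ θ ∈ box u, S = {x ∈ box u | LexLE γ x ∧ LexLE x θ} := by
  have hfin := (box_finite u).subset hS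
  obtain ⟨γ, hγ, hmin⟩ := Set.exists_min_image S toColex hfin hne
  obtain ⟨θ, hθ, hmax⟩ := Set.exists_max_image S toColex hfin hne
  refine ⟨γ, hS hγ, θ, hS hθ, ?_⟩
  ext x
  exact ⟨fun hx => ⟨hS hx, hmin x hx, hmax x hx⟩, fun hx => hc _ hγ _ hθ _ hx.1 hx.2.1 hx.2.2⟩

theorem describedBy_conv_of_ordConvex {n : ℕ} (hn : 0 < n) {u : Fin n → ℤ}
    {S : Set (Fin n → ℤ)} (hS : S ⊆ box u)
    (hc : ∀ x ∈ S, ∀ y ∈ S, ∀ z ∈ box u, LexLE x z → LexLE z y → z ∈ S) :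
    DescribedBy (conv S) (4 * n) := by
  rcases S.eq_empty_or_nonempty with rfl | hne
  · rw [conv_empty]
    -- The empty set costs one inequality, within `4 * n` because `0 < n`.
    exact describedBy_empty.mono (by omega)
  · obtain ⟨γ, hγ, θ, hθ, rfl⟩ := exists_eq_interval hS hne hc
    rw [conv_interval_eq_intervalPolytope hγ hθ]
    exact describedBy_intervalPolytope u γ θ

/-! ### Consequences for superincreasing knapsacks. -/

theorem conv_knapsackLE_inter_knapsackGE {n : ℕ} {u a w : Fin n → ℤ} {b d : ℤ} (hn : 0 < n)
    (hu : ∀ i, 0 < u i) (ha : ∀ i, 0 < a i) (hw : ∀ i, 0 < w i) (hb : 0 ≤ b)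
    (hsa : Superincreasing a u) (hsw : Superincreasing w u) :
    conv (knapsackLE a u b ∩ knapsackGE w u d) =
      conv (knapsackLE a u b) ∩ conv (knapsackGE w u d) := by
  rcases (knapsackGE w u d).eq_empty_or_nonempty with h | h
  -- Treated apart because the minimal packing may leave the box here.
  · rw [h, Set.inter_empty, conv_empty, Set.inter_empty]
  · have hγ := minPacking_mem_box hu hw h
    rw [knapsackLE_eq hn hu ha hsa, knapsackGE_eq hn hu hw hsw, Set.inter_comm (conv _),
      ← conv_interval_eq_inter hγ (greedy_mem_box ha hu hb)]
    congr 1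
    ext x
    exact ⟨fun h => ⟨h.1.1, h.2.2, h.1.2⟩, fun h => ⟨⟨h.1, h.2.2⟩, h.1, h.2.1⟩⟩

theorem describedBy_conv_iInter_knapsack {n p q : ℕ} {u : Fin n → ℤ} {a : Fin p → Fin n → ℤ}
    {b : Fin p → ℤ} {w : Fin q → Fin n → ℤ} {d : Fin q → ℤ} (hn : 0 < n) (hpq : 0 < p + q)
    (hu : ∀ i, 0 < u i) (ha : ∀ s, (∀ i, 0 < a s i) ∧ Superincreasing (a s) u)
    (hw : ∀ t, (∀ i, 0 < w t i) ∧ Superincreasing (w t) u) :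
    DescribedBy (conv ((⋂ s, knapsackLE (a s) u (b s)) ∩ ⋂ t, knapsackGE (w t) u (d t)))
      (4 * n) := by
  refine describedBy_conv_of_ordConvex hn (u := u) ?_ ?_
  · rintro x ⟨h1, h2⟩
    rcases Nat.eq_zero_or_pos p with hp | hp
    · exact (Set.mem_iInter.1 h2 ⟨0, by omega⟩).1
    · exact (Set.mem_iInter.1 h1 ⟨0, hp⟩).1
  -- In the box, `≤`-knapsacks are closed downwards and `≥`-knapsacks upwards.
  · rintro x ⟨-, hx⟩ y ⟨hy, -⟩ z hz hxz hzy
    refine ⟨Set.mem_iInter.2 fun s => ?_, Set.mem_iInter.2 fun t => ?_⟩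
    · have h := Set.mem_iInter.1 hy s
      rw [knapsackLE_eq hn hu (ha s).1 (ha s).2] at h ⊢
      exact ⟨hz, hzy.trans h.2⟩
    · have h := Set.mem_iInter.1 hx t
      rw [knapsackGE_eq hn hu (hw t).1 (hw t).2] at h ⊢
      exact ⟨hz, h.2.trans hxz⟩

end SuperincreasingKnapsack

open SuperincreasingKnapsack in
theorem theorem2 :
    -- for any two vectors of the box
    (∀ (n : ℕ) (u γ θ : Fin n → ℤ), 0 < n → (∀ i, 0 < u i) → γ ∈ box u → θ ∈ box u →
      conv {x ∈ box u | LexLE γ x ∧ LexLE x θ} =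
        conv {x ∈ box u | LexLE γ x} ∩ conv {x ∈ box u | LexLE x θ}) ∧
    -- for two superincreasing knapsacks, with their maximal and minimal packings
    (∀ (n : ℕ) (u a w : Fin n → ℤ) (b d : ℤ), 0 < n → (∀ i, 0 < u i) →
      (∀ i, 0 < a i) → (∀ i, 0 < w i) → 0 < b → 0 < d →
      Superincreasing a u → Superincreasing w u →
        knapsackLE a u b = {x ∈ box u | LexLE x (greedy a u b)} ∧
        knapsackGE w u d = {x ∈ box u | LexLE (minPacking w u d) x} ∧
        conv (knapsackLE a u b ∩ knapsackGE w u d) =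
          conv (knapsackLE a u b) ∩ conv (knapsackGE w u d)) ∧
    -- for finitely many superincreasing knapsacks, at most `C * n` inequalities suffice
    (∃ C : ℕ, ∀ (n : ℕ) (u : Fin n → ℤ) (p q : ℕ)
      (a : Fin p → Fin n → ℤ) (b : Fin p → ℤ) (w : Fin q → Fin n → ℤ) (d : Fin q → ℤ),
      0 < n → 0 < p + q → (∀ i, 0 < u i) →
      (∀ s, (∀ i, 0 < a s i) ∧ 0 < b s ∧ Superincreasing (a s) u) →
      (∀ t, (∀ i, 0 < w t i) ∧ 0 < d t ∧ Superincreasing (w t) u) →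
        DescribedBy
          (conv ((⋂ s, knapsackLE (a s) u (b s)) ∩ ⋂ t, knapsackGE (w t) u (d t)))
          (C * n)) := by
  refine ⟨fun n u γ θ _ _ hγ hθ => conv_interval_eq_inter hγ hθ,
    fun n u a w b d hn hu ha hw hb _ hsa hsw =>
      ⟨knapsackLE_eq hn hu ha hsa, knapsackGE_eq hn hu hw hsw,
        conv_knapsackLE_inter_knapsackGE hn hu ha hw hb.le hsa hsw⟩,
    4, fun n u p q a b w d hn hpq hu ha hw =>
      describedBy_conv_iInter_knapsack hn hpq hu (fun s => ⟨(ha s).1, (ha s).2.2⟩)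
        fun t => ⟨(hw t).1, (hw t).2.2⟩⟩
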